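/- **Fixed-precision numbers.** For integers $p\ge 1$ and $0\le s\le p$ let $\mathbb F=\mathbb F_{p,s}$ be the set of numbers $m2^{-s}$ with $m\in\mathbb Z$, $-2^{p-1}\le m<2^{p-1}$. For $x\in\mathbb R$ let $\mathrm{round}(x)$ be the greatest element of $\mathbb F$ that is $\le x$ (and $\min\mathbb F$ if there is none); on vectors it acts coordinatewise. **Transformers.** A (future-masked) fixed-precision transformer $T$ with bit precision $p$, hidden dimension $d$ and depth $L$ over an alphabet $\Gamma$ is given by arbitrary functions $E:\Gamma\to\mathbb F^d$, $W_Q^{(\ell)},W_K^{(\ell)},W_V^{(\ell)},f^{(\ell)}:\mathbb F^d\to\mathbb F^d$ ($1\le\ell\le L$) and $W_{\rm out}:\mathbb F^d\to\mathbb F$. On $x\in\Gamma^n$ it computes $h^{(0)}_i=E(x_i)$ and, for $\ell=1,\dots,L$, with $q_i=W_Q^{(\ell)}(h_i^{(\ell-1)})$, $k_i=W_K^{(\ell)}(h_i^{(\ell-1)})$, $v_i=W_V^{(\ell)}(h_i^{(\ell-1)})$, $$A_{ij}=\mathrm{round}(\exp(q_i\cdot k_j)),\quad B_i=\sum_{j\le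 i}A_{ij},\quad \alpha_{ij}=\mathrm{round}(A_{ij}/B_i),\quad c_i=\mathrm{round}\Big(\sum_{j\le i}\alpha_{ij}v_j\Big),$$ $$h^{(\ell)}_i=f^{(\ell)}\big(\mathrm{round}(c_i+h^{(\ell-1)}_i)\big),$$ where $B_i$ is not rounded and $\alpha_{ij}=\mathrm{round}(1/i)$ for all $j\le i$ if $B_i=0$. Its output at position $i$ is $T(x)_i=W_{\rm out}(h^{(L)}_i)$, and $T$ accepts $x$ if $T(x)_n>0$. **Programs.** Formulas of $\mathsf{C\text{-}RASP}_+$ over a finite alphabet $\Sigma$ are given by $$\phi::= Q_\sigma\mid\neg\phi\mid\phi\wedge\phi\mid\sum_{t\in\mathcal T}\alpha_t t\sim k,\qquad t::=\#[\phi]\mid c,$$ with $\sigma\in\Sigma$, $\alpha_t,k,c\in\mathbb N$ and $\sim\in\{<,\le,=,\ge,>\}$. At position $i$ of $w$, $Q_\sigma$ means $w_i=\sigma$ and $\#[\phi]$ is the number of $j\in[1,i]$ with $w,j\models\phi$; at position $0$ no $Q_\sigma$ holds and all counts are $0$. A program is a nonempty sequence of lines, each a formula that may also refer to earlier lines; $w,i\models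 P$ means that the last line holds at position $i$ of $w$, and $P$ accepts $w$ if $w,|w|\models P$. The *size* of $P$ is the total number of symbols of its lines (numbers in binary, a reference counting as one symbol); its *depth* is the maximal nesting depth of $\#$, references being unfolded; its *precision* is the number of bits of its largest constant; its *girth* is the maximal number of summands in a sum. $P$ *simulates* a transformer $T$ over $\Sigma\cup\{\texttt{<BOS>}\}$ if for all $w\in\Sigma^*$ and $0\le i\le|w|$: $w,i\models P$ if and only if $T(\texttt{<BOS>}\cdot w)_{i+1}>0$. (So $P$ accepts $w$ iff $T$ accepts $\texttt{<BOS>}\cdot w$.) **Theorem.** There is an absolute constant $C$ such that for every nonempty finite alphabet $\Sigma$, all integers $p,d,L\ge1$ and $0\le s\le p$, and every fixed-precision transformer $T$ over $\Sigma\cup\{\texttt{<BOS>}\}$ with bit precision $p$ ($s$ of the bits fractional), hidden dimension $d$ and depth $L$, there is a $\mathsf{C\text{-}RASP}_+$ program $P$ over $\Sigma$ that simulates $T$ and has size at most $C\,|\Sigma|\,L\,p^2\,d\,2^{p^3d}$, depth at most $C L$, precision at most $C p$ and girth at most $C p$. -/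

import Mathlib

open scoped BigOperators

universe u

/-! ### The positive fragment of counting RASP -/

/-- The comparison symbols. -/
inductive CmpRel where
  | lt | le | eq | ge | gt

/-- The comparison of natural numbers denoted by a comparison symbol. -/
def CmpRel.Holds : CmpRel → ℕ → ℕ → Prop
  | .lt, a, b => a < b
  | .le, a, b => a ≤ b
  | .eq, a, b => a = b
  | .ge, a, b => a ≥ b
  | .gt, a, b => a > b

/-- Formulas of the positive fragment of C-RASP over the alphabet `σ`, as they occur in a line of a
program: `ref j` is a reference to the `j`-th line. The formula `compare m a φ l b c r k` is the
comparison `∑ t < m, a t · #[φ t] + ∑ t < l, b t · c t ∼ k`: it has `m` summands whose term is a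
count and `l` summands whose term is a constant, and all numbers in it are natural numbers. -/
inductive CRaspFormula (σ : Type u) : Type u where
  | sym (a : σ) : CRaspFormula σ
  | ref (j : ℕ) : CRaspFormula σ
  | neg (φ : CRaspFormula σ) : CRaspFormula σ
  | conj (φ ψ : CRaspFormula σ) : CRaspFormula σ
  | compare (m : ℕ) (a : Fin m → ℕ) (φ : Fin m → CRaspFormula σ)
      (l : ℕ) (b c : Fin l → ℕ) (r : CmpRel) (k : ℕ) : CRaspFormula σ

/-- The number of binary digits of a natural number (one digit for `0`). -/
def bitLength (n : ℕ) : ℕ := Nat.log 2 n + 1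

namespace CRaspFormula

variable {σ : Type u}

/-- All references in the formula are to lines with index below `n`. -/
def RefsBelow (n : ℕ) : CRaspFormula σ → Prop
  | sym _ => True
  | ref j => j < n
  | neg φ => φ.RefsBelow n
  | conj φ ψ => φ.RefsBelow n ∧ ψ.RefsBelow n
  | compare _ _ φ _ _ _ _ _ => ∀ t, (φ t).RefsBelow n

open Classical in
/-- `φ.Sat w env i` is `w, i ⊨ φ`, where `env j` is the set of positions at which line `j` holds.
Positions of `w` are `1, …, w.length`. Position `0` precedes the first symbol: no symbol occurs
there and all counts are `0`; it is the last position of the empty string. -/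
noncomputable def Sat (w : List σ) (env : ℕ → ℕ → Prop) : CRaspFormula σ → ℕ → Prop
  | sym a, i => 1 ≤ i ∧ w[i - 1]? = some a
  | ref j, i => env j i
  | neg φ, i => ¬ φ.Sat w env i
  | conj φ ψ, i => φ.Sat w env i ∧ ψ.Sat w env i
  | compare _ a φ _ b c r k, i =>
      r.Holds (∑ t, a t * ((Finset.Icc 1 i).filter fun j => (φ t).Sat w env j).card
        + ∑ t, b t * c t) k

/-- Number of symbols, with numbers written in binary and a reference counted as one symbol. Each
summand of a sum contributes, besides its numbers and subformula, one symbol for the plus sign, and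
a count contributes one symbol for the counting operator. -/
def size : CRaspFormula σ → ℕ
  | sym _ => 1
  | ref _ => 1
  | neg φ => φ.size + 1
  | conj φ ψ => φ.size + ψ.size + 1
  | compare _ a φ _ b c _ k =>
      ∑ t, (bitLength (a t) + (φ t).size + 2) + ∑ t, (bitLength (b t) + bitLength (c t) + 1)
        + 1 + bitLength k

/-- Nesting depth of counting, where `env j` is the depth of line `j`. -/
def depth (env : ℕ → ℕ) : CRaspFormula σ → ℕ
  | sym _ => 0
  | ref j => env j
  | neg φ => φ.depth env
  | conj φ ψ => max (φ.depth env) (ψ.depth env)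
  | compare _ _ φ _ _ _ _ _ => Finset.univ.sup fun t => (φ t).depth env + 1

/-- Largest number of binary digits of a number occurring in the formula. -/
def precision : CRaspFormula σ → ℕ
  | sym _ => 0
  | ref _ => 0
  | neg φ => φ.precision
  | conj φ ψ => max φ.precision ψ.precision
  | compare _ a φ _ b c _ k =>
      max (Finset.univ.sup fun t => max (bitLength (a t)) (φ t).precision)
        (max (Finset.univ.sup fun t => max (bitLength (b t)) (bitLength (c t))) (bitLength k))

/-- Largest number of summands of a sum occurring in the formula. -/
def girth : CRaspFormula σ → ℕ
  | sym _ => 0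
  | ref _ => 0
  | neg φ => φ.girth
  | conj φ ψ => max φ.girth ψ.girth
  | compare m _ φ l _ _ _ _ => max (m + l) (Finset.univ.sup fun t => (φ t).girth)

end CRaspFormula

/-- A straight-line program: a nonempty sequence of lines, each of which is a formula that may refer
to earlier lines. The last line is the output. -/
structure CRaspProgram (σ : Type u) where
  lines : List (CRaspFormula σ)
  nonempty : lines ≠ []
  refs_lt : ∀ (i : ℕ) (h : i < lines.length), (lines[i]).RefsBelow i

namespace CRaspProgram

variable {σ : Type u}

/-- Processes lines in order, the first one being line `n`. Each line gets the value that `f`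
computes from the values of the preceding lines, which `env` records. -/
def run {β : Type*} (f : (ℕ → β) → CRaspFormula σ → β) :
    ℕ → (ℕ → β) → List (CRaspFormula σ) → (ℕ → β)
  | _, env, [] => env
  | n, env, φ :: l => run f (n + 1) (Function.update env n (f env φ)) l

/-- Line `j` of the program holds in `w` at position `i`. -/
noncomputable def lineHolds (P : CRaspProgram σ) (w : List σ) : (j i : ℕ) → Prop :=
  run (fun env φ i => φ.Sat w env i) 0 (fun _ _ => False) P.lines

/-- `w, i ⊨ P`: the last line of `P` holds in `w` at position `i`. -/
noncomputable def Holds (P : CRaspProgram σ) (w : List σ) (i : ℕ) : Prop :=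
  P.lineHolds w (P.lines.length - 1) i

/-- Counting depth of line `j`, references being unfolded. -/
def lineDepth (P : CRaspProgram σ) : (j : ℕ) → ℕ :=
  run (fun env φ => φ.depth env) 0 (fun _ => 0) P.lines

/-- Size: total number of symbols in the lines. -/
def size (P : CRaspProgram σ) : ℕ := (P.lines.map CRaspFormula.size).sum

/-- Depth: largest depth of a line. -/
def depth (P : CRaspProgram σ) : ℕ := (Finset.range P.lines.length).sup P.lineDepth

/-- Precision: number of bits of the largest constant. -/
def precision (P : CRaspProgram σ) : ℕ := (P.lines.map CRaspFormula.precision).foldr max 0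

/-- Girth: largest number of summands of a sum. -/
def girth (P : CRaspProgram σ) : ℕ := (P.lines.map CRaspFormula.girth).foldr max 0

end CRaspProgram

/-! ### Fixed-precision numbers -/

/-- Fixed-precision numbers with `p` total bits and `s` fractional bits: the rational numbers
`mant * 2 ^ (-s)` with `-2 ^ (p - 1) ≤ mant < 2 ^ (p - 1)` (for `p ≥ 1`). -/
@[ext]
structure FixedNum (p s : ℕ) where
  mant : ℤ
  lower : -(2 : ℤ) ^ (p - 1) ≤ mant
  upper : mant < (2 : ℤ) ^ (p - 1)

namespace FixedNum

variable {p s : ℕ}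

/-- The number that a fixed-precision number represents. -/
noncomputable def toReal (x : FixedNum p s) : ℝ := (x.mant : ℝ) / 2 ^ s

/-- Rounding: the greatest fixed-precision number that is at most `x`, or the least fixed-precision
number if there is none; see `round_isGreatest` and `round_of_lt`. -/
noncomputable def round (p s : ℕ) (x : ℝ) : FixedNum p s where
  mant := max (-(2 : ℤ) ^ (p - 1)) (min ((2 : ℤ) ^ (p - 1) - 1) ⌊x * 2 ^ s⌋)
  lower := le_max_left _ _
  upper := by
    have h : (0 : ℤ) < 2 ^ (p - 1) := by positivity
    exact max_lt (by linarith) (lt_of_le_of_lt (min_le_left _ _) (by linarith))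

theorem round_isGreatest (y₀ : FixedNum p s) (x : ℝ) (h₀ : y₀.toReal ≤ x) :
    (round p s x).toReal ≤ x ∧
      ∀ y : FixedNum p s, y.toReal ≤ x → y.toReal ≤ (round p s x).toReal := by
  have h2 : (0 : ℝ) < 2 ^ s := by positivity
  have key : ∀ y : FixedNum p s, y.toReal ≤ x ↔ y.mant ≤ ⌊x * 2 ^ s⌋ := by
    intro y
    rw [Int.le_floor, toReal, div_le_iff₀ h2]
  refine ⟨(key _).2 ?_, fun y hy => ?_⟩
  · exact max_le (y₀.lower.trans ((key _).1 h₀)) (min_le_right _ _)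
  · have h3 : y.mant ≤ (round p s x).mant :=
      le_max_of_le_right (le_min (by linarith [y.upper]) ((key y).1 hy))
    have h4 : (y.mant : ℝ) ≤ ((round p s x).mant : ℝ) := by exact_mod_cast h3
    exact div_le_div_of_nonneg_right h4 h2.le

theorem round_of_lt (x : ℝ) (h : ∀ y : FixedNum p s, x < y.toReal) (y : FixedNum p s) :
    (round p s x).toReal ≤ y.toReal := by
  have h2 : (0 : ℝ) < 2 ^ s := by positivity
  have hpow : (0 : ℤ) < 2 ^ (p - 1) := by positivity
  have h1 := h ⟨-(2 : ℤ) ^ (p - 1), le_rfl, by linarith⟩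
  have h5 : ⌊x * 2 ^ s⌋ < -(2 : ℤ) ^ (p - 1) := by
    rw [Int.floor_lt]
    rwa [toReal, lt_div_iff₀ h2] at h1
  have h3 : (round p s x).mant ≤ y.mant :=
    max_le y.lower ((min_le_right _ _).trans (h5.le.trans y.lower))
  have h4 : ((round p s x).mant : ℝ) ≤ (y.mant : ℝ) := by exact_mod_cast h3
  exact div_le_div_of_nonneg_right h4 h2.le

end FixedNum

/-! ### Fixed-precision transformers -/

/-- Vectors of `d` fixed-precision numbers. -/
abbrev FixedVec (p s d : ℕ) : Type := Fin d → FixedNum p s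

/-- The functions that define one layer: query, key, value and feed-forward. -/
structure TransformerLayer (p s d : ℕ) where
  query : FixedVec p s d → FixedVec p s d
  key : FixedVec p s d → FixedVec p s d
  value : FixedVec p s d → FixedVec p s d
  ff : FixedVec p s d → FixedVec p s d

namespace TransformerLayer

variable {p s d n : ℕ}

/-- The rounded exponential `round (exp (q_i · k_j))`, where `h` are the input activations. -/
noncomputable def score (Λ : TransformerLayer p s d) (h : Fin n → FixedVec p s d)
    (i j : Fin n) : ℝ :=
  (FixedNum.round p s
    (Real.exp (∑ c, (Λ.query (h i) c).toReal * (Λ.key (h j) c).toReal))).toReal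

/-- The sum of the scores of all positions `j ≤ i`. It is not rounded. -/
noncomputable def denom (Λ : TransformerLayer p s d) (h : Fin n → FixedVec p s d)
    (i : Fin n) : ℝ :=
  ∑ j ∈ Finset.Iic i, Λ.score h i j

open Classical in
/-- The rounded attention weight. If the denominator is `0`, attention is uniform: each of the
`i + 1` positions `j ≤ i` has the weight `1 / (i + 1)`, which is rounded like any other weight. -/
noncomputable def weight (Λ : TransformerLayer p s d) (h : Fin n → FixedVec p s d)
    (i j : Fin n) : FixedNum p s :=
  FixedNum.round p s
    (if Λ.denom h i = 0 then 1 / ((i : ℝ) + 1) else Λ.score h i j / Λ.denom h i)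

/-- The output of future-masked self-attention. -/
noncomputable def attention (Λ : TransformerLayer p s d) (h : Fin n → FixedVec p s d)
    (i : Fin n) : FixedVec p s d :=
  fun c => FixedNum.round p s
    (∑ j ∈ Finset.Iic i, (Λ.weight h i j).toReal * (Λ.value (h j) c).toReal)

/-- The output activations of the layer. The residual sum is rounded to a fixed-precision number
before the feed-forward function is applied. -/
noncomputable def apply (Λ : TransformerLayer p s d) (h : Fin n → FixedVec p s d)
    (i : Fin n) : FixedVec p s d :=
  Λ.ff fun c => FixedNum.round p s ((Λ.attention h i c).toReal + (h i c).toReal)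

end TransformerLayer

/-- A fixed-precision transformer over the alphabet `Γ`, with `p` total bits, `s` fractional bits
and hidden dimension `d`. -/
structure FixedTransformer (Γ : Type u) (p s d : ℕ) where
  embed : Γ → FixedVec p s d
  layers : List (TransformerLayer p s d)
  unembed : FixedVec p s d → FixedNum p s

namespace FixedTransformer

variable {Γ : Type u} {p s d n : ℕ}

/-- Depth: the number of layers. -/
def depth (T : FixedTransformer Γ p s d) : ℕ := T.layers.length

/-- The activations after the last layer on the input string `x` of length `n`. -/
noncomputable def hidden (T : FixedTransformer Γ p s d) (x : Fin n → Γ) :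
    Fin n → FixedVec p s d :=
  T.layers.foldl (fun h Λ => Λ.apply h) fun i => T.embed (x i)

/-- The output at position `i`; the output on `x` is the one at the last position. -/
noncomputable def output (T : FixedTransformer Γ p s d) (x : Fin n → Γ) (i : Fin n) :
    FixedNum p s :=
  T.unembed (T.hidden x i)

end FixedTransformer

/-- The string `w` with the beginning-of-string symbol `none` in front. The index `0` is that symbol
and the index `i ≥ 1` is the `i`-th symbol of `w`. -/
def withBOS {σ : Type u} (w : List σ) : Fin (w.length + 1) → Option σ :=
  Fin.cons none fun i => some (w.get i)

/-- `P` simulates `T`: for every string `w`, `P` holds at position `i` of `w` if and only if the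
output of `T` on `w` with the beginning-of-string symbol in front is positive at the same symbol.
For `i = w.length` this says that `P` accepts `w` if and only if `T` accepts `withBOS w`. -/
def CRaspProgram.Simulates {σ : Type u} {p s d : ℕ} (P : CRaspProgram σ)
    (T : FixedTransformer (Option σ) p s d) : Prop :=
  ∀ (w : List σ) (i : Fin (w.length + 1)), P.Holds w i ↔ 0 < (T.output (withBOS w) i).toReal

/-! After every layer the activation of a position is one of finitely many vectors, its state, and
the program keeps one line per layer and state `u` that holds exactly at the positions in state `u`.
Such lines can be carried through a layer because a new state depends only on the old state `v` of
the position and on its attention vector, and the latter depends only on a few bounded sums over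
earlier positions.

Attention is first rewritten over ℕ: scores, weights and values become numerators over `2 ^ s`, and
rounding becomes capped natural division (`weight_eq`, `attention_eq`). Since comparisons are with
constants and subtraction is absent, positive and negative parts are summed separately. The score
sum and the number of positions matter only up to `2 ^ (2 * p)`, beyond which all quotients are `0`
(`weightNat_min`); the rounded weights have numerators summing to at most `2 ^ s`, so the two final
sums stay below `2 ^ (2 * p)` (`sum_posPart_lt`). A formula can therefore guess all these numbers,
by finite disjunction, and check each guess by counting (`sat_attentionFormula`).

A sum of `f (state)` is checked as a sum of `2 ^ b` times the number of positions where bit `b` of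
`f (state)` is set (`sat_truncSum`). This keeps the girth linear in `p`, independent of the number
of states. The beginning-of-string position is never counted; its state does not depend on the word
(`apply_zero`), so it enters as a constant summand. The guessed values are parameters of the
formulas rather than counts, so each layer adds only one level of counting. -/

namespace CRaspFormula

/-! ### Derived connectives, their size and their resource bounds. -/

variable {σ : Type u}

/-- A formula that never holds. -/
def fls : CRaspFormula σ := compare 0 Fin.elim0 Fin.elim0 0 Fin.elim0 Fin.elim0 .gt 0

/-- Disjunction. -/
def disj (φ ψ : CRaspFormula σ) : CRaspFormula σ := neg (conj (neg φ) (neg ψ))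

/-- Disjunction of a list of formulas. -/
def listDisj (l : List (CRaspFormula σ)) : CRaspFormula σ := l.foldr disj fls

/-- Disjunction over a finite type. -/
noncomputable def bigDisj {ι : Type*} [Fintype ι] (φ : ι → CRaspFormula σ) : CRaspFormula σ :=
  listDisj (Finset.univ.toList.map φ)

/-- Conjunction over a finite type. -/
noncomputable def bigConj {ι : Type*} [Fintype ι] (φ : ι → CRaspFormula σ) : CRaspFormula σ :=
  neg (bigDisj fun x => neg (φ x))

open Classical in
/-- The formula `φ` if `c` is true, and a formula that never holds otherwise. -/
noncomputable def guarded (c : Prop) (φ : CRaspFormula σ) : CRaspFormula σ := if c then φ else fls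

section Sat

variable (w : List σ) (env : ℕ → ℕ → Prop) (i : ℕ)

@[simp] theorem sat_fls : ¬ (fls : CRaspFormula σ).Sat w env i := by
  simp [fls, Sat, CmpRel.Holds]

@[simp] theorem sat_neg (φ : CRaspFormula σ) : (neg φ).Sat w env i ↔ ¬ φ.Sat w env i := Iff.rfl

@[simp] theorem sat_conj (φ ψ : CRaspFormula σ) :
    (conj φ ψ).Sat w env i ↔ φ.Sat w env i ∧ ψ.Sat w env i := Iff.rfl

@[simp] theorem sat_ref (j : ℕ) : (ref j : CRaspFormula σ).Sat w env i ↔ env j i := Iff.rfl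

@[simp] theorem sat_disj (φ ψ : CRaspFormula σ) :
    (disj φ ψ).Sat w env i ↔ φ.Sat w env i ∨ ψ.Sat w env i := by
  simp only [disj, sat_neg, sat_conj]; tauto

@[simp] theorem sat_bigDisj {ι : Type*} [Fintype ι] (φ : ι → CRaspFormula σ) :
    (bigDisj φ).Sat w env i ↔ ∃ x, (φ x).Sat w env i := by
  have key : ∀ l : List ι, (listDisj (l.map φ)).Sat w env i ↔ ∃ x ∈ l, (φ x).Sat w env i := by
    intro l
    induction l with
    | nil => simp [listDisj]
    | cons a l ih =>
      have : listDisj ((a :: l).map φ) = disj (φ a) (listDisj (l.map φ)) := rfl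
      rw [this, sat_disj, ih]; simp
  simp [bigDisj, key]

@[simp] theorem sat_bigConj {ι : Type*} [Fintype ι] (φ : ι → CRaspFormula σ) :
    (bigConj φ).Sat w env i ↔ ∀ x, (φ x).Sat w env i := by
  simp [bigConj]

@[simp] theorem sat_guarded (c : Prop) (φ : CRaspFormula σ) :
    (guarded c φ).Sat w env i ↔ c ∧ φ.Sat w env i := by
  by_cases h : c <;> simp [guarded, h]

end Sat

section Size

theorem size_fls : (fls : CRaspFormula σ).size = 2 := by simp [fls, size, bitLength]

theorem size_guarded_le {c : Prop} {φ : CRaspFormula σ} {B : ℕ} (h2 : 2 ≤ B) (h : φ.size ≤ B) :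
    (guarded c φ).size ≤ B := by
  unfold guarded; split_ifs
  · exact h
  · rw [size_fls]; exact h2

theorem size_bigDisj_le {ι : Type*} [Fintype ι] {φ : ι → CRaspFormula σ} {B : ℕ}
    (h : ∀ x, (φ x).size ≤ B) : (bigDisj φ).size ≤ Fintype.card ι * (B + 4) + 2 := by
  have key : ∀ l : List ι, (listDisj (l.map φ)).size ≤ l.length * (B + 4) + 2 := by
    intro l
    induction l with
    | nil => simp [listDisj, size_fls]
    | cons a l ih =>
      have : (listDisj ((a :: l).map φ)).size = (φ a).size + 1 + ((listDisj (l.map φ)).size + 1)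
          + 1 + 1 := rfl
      rw [this, List.length_cons, Nat.succ_mul]
      have := h a
      omega
  simpa [bigDisj] using key Finset.univ.toList

theorem size_bigConj_le {ι : Type*} [Fintype ι] {φ : ι → CRaspFormula σ} {B : ℕ}
    (h : ∀ x, (φ x).size ≤ B) : (bigConj φ).size ≤ Fintype.card ι * (B + 5) + 3 := by
  have := size_bigDisj_le (φ := fun x => neg (φ x)) (B := B + 1)
    (fun x => by simpa [size] using h x)
  simp only [bigConj, size]
  rw [show B + 1 + 4 = B + 5 from rfl] at this
  omega

end Size

/-- All references are to lines below `n`, the counting depth is at most `D`, and the precision and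
the girth are at most `q`. -/
structure Bounded (n : ℕ) (env : ℕ → ℕ) (D q : ℕ) (φ : CRaspFormula σ) : Prop where
  refs : φ.RefsBelow n
  depth_le : φ.depth env ≤ D
  precision_le : φ.precision ≤ q
  girth_le : φ.girth ≤ q

namespace Bounded

variable {n : ℕ} {env : ℕ → ℕ} {D q : ℕ}

theorem sym (a : σ) : Bounded n env D q (.sym a) := by
  constructor <;> simp [RefsBelow, depth, precision, girth]

theorem ref {j : ℕ} (hj : j < n) (hD : env j ≤ D) :
    Bounded n env D q (.ref j : CRaspFormula σ) := by
  constructor <;> simp [RefsBelow, depth, precision, girth, hj, hD]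

theorem neg {φ : CRaspFormula σ} (h : Bounded n env D q φ) : Bounded n env D q φ.neg :=
  ⟨h.refs, h.depth_le, h.precision_le, h.girth_le⟩

theorem conj {φ ψ : CRaspFormula σ} (h : Bounded n env D q φ) (h' : Bounded n env D q ψ) :
    Bounded n env D q (φ.conj ψ) :=
  ⟨⟨h.refs, h'.refs⟩, max_le h.depth_le h'.depth_le, max_le h.precision_le h'.precision_le,
    max_le h.girth_le h'.girth_le⟩

theorem disj {φ ψ : CRaspFormula σ} (h : Bounded n env D q φ) (h' : Bounded n env D q ψ) :
    Bounded n env D q (φ.disj ψ) := (h.neg.conj h'.neg).neg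

theorem fls (hq : 1 ≤ q) : Bounded n env D q (fls : CRaspFormula σ) := by
  constructor <;> simp [CRaspFormula.fls, RefsBelow, depth, precision, girth, bitLength, hq]

theorem guarded (hq : 1 ≤ q) {c : Prop} {φ : CRaspFormula σ} (h : Bounded n env D q φ) :
    Bounded n env D q (guarded c φ) := by
  unfold CRaspFormula.guarded; split_ifs
  · exact h
  · exact fls hq

theorem bigDisj (hq : 1 ≤ q) {ι : Type*} [Fintype ι] {φ : ι → CRaspFormula σ}
    (h : ∀ x, Bounded n env D q (φ x)) : Bounded n env D q (bigDisj φ) := by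
  unfold CRaspFormula.bigDisj
  induction (Finset.univ : Finset ι).toList with
  | nil => exact fls hq
  | cons a l ih => exact (h a).disj ih

theorem bigConj (hq : 1 ≤ q) {ι : Type*} [Fintype ι] {φ : ι → CRaspFormula σ}
    (h : ∀ x, Bounded n env D q (φ x)) : Bounded n env D q (bigConj φ) :=
  (bigDisj hq fun x => (h x).neg).neg

end Bounded

/-! ### Weighted sums over positions -/

theorem bitLength_two_pow (b : ℕ) : bitLength (2 ^ b) = b + 1 := by
  simp [bitLength]

theorem bitLength_le_of_lt {n b : ℕ} (hb : 1 ≤ b) (h : n < 2 ^ b) : bitLength n ≤ b := by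
  rcases Nat.eq_zero_or_pos n with rfl | hn
  · simpa [bitLength] using hb
  · exact Nat.log_lt_of_lt_pow hn.ne' h

/-- Binary expansion, by induction after splitting off the lowest bit. -/
theorem sum_two_pow_testBit (m n : ℕ) (h : n < 2 ^ m) :
    ∑ b ∈ Finset.range m, 2 ^ b * (if n.testBit b then 1 else 0) = n := by
  induction m generalizing n with
  | zero => simp at h; simp [h]
  | succ m ih =>
    rw [Finset.sum_range_succ']
    have h2 : n / 2 < 2 ^ m := by rw [pow_succ] at h; omega
    have := ih (n / 2) h2
    have h3 : ∑ b ∈ Finset.range m, 2 ^ (b + 1) * (if n.testBit (b + 1) then 1 else 0)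
        = 2 * (n / 2) := by
      conv_rhs => rw [← this]
      rw [Finset.mul_sum]
      refine Finset.sum_congr rfl fun b _ => ?_
      rw [Nat.testBit_succ, pow_succ]; ring
    rw [h3, Nat.testBit_zero]
    rcases Nat.mod_two_eq_zero_or_one n with h4 | h4 <;> simp [h4] <;> omega

variable {S : Type*} [Fintype S]

/-- The formula saying that the `b`-th bit of the value of `f` at the current state is `1`, where
line `idx u` says that the state is `u`. -/
noncomputable def stateBit (idx : S → ℕ) (f : S → ℕ) (b : ℕ) : CRaspFormula σ :=
  bigDisj fun u => guarded ((f u).testBit b = true) (ref (idx u))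

/-- The formula saying that the sum of the values of `f` at the states of all positions up to the
current one, truncated to at most `2 ^ m`, is `k`. The initial state is `z`. -/
noncomputable def truncSum (m : ℕ) (idx : S → ℕ) (z : S) (f : S → ℕ) (k : ℕ) : CRaspFormula σ :=
  compare m (fun t => 2 ^ (t : ℕ)) (fun t => stateBit idx f t) 1 (fun _ => 1) (fun _ => f z)
    (if k < 2 ^ m then .eq else .ge) k

theorem size_truncSum_le {m : ℕ} (hm : 1 ≤ m) {idx : S → ℕ} {z : S} {f : S → ℕ}
    (hf : ∀ u, f u < 2 ^ m) {k : ℕ} (hk : k ≤ 2 ^ m) :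
    (truncSum m idx z f k : CRaspFormula σ).size
      ≤ m * (m + 6 * Fintype.card S + 4) + 2 * m + 4 := by
  have h1 : ∀ t : Fin m, bitLength (2 ^ (t : ℕ)) + (stateBit idx f t : CRaspFormula σ).size + 2
      ≤ m + 6 * Fintype.card S + 4 := by
    intro t
    have : (stateBit idx f t : CRaspFormula σ).size ≤ Fintype.card S * (2 + 4) + 2 :=
      size_bigDisj_le fun u => size_guarded_le le_rfl (by simp [size])
    have := t.2
    rw [bitLength_two_pow]; omega
  have h2 := Finset.sum_le_sum fun t (_ : t ∈ Finset.univ) => h1 t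
  have h3 : bitLength (f z) ≤ m := bitLength_le_of_lt hm (hf z)
  have h4 : bitLength k ≤ m + 1 :=
    bitLength_le_of_lt (by omega) (hk.trans_lt (Nat.pow_lt_pow_right (by norm_num) (by omega)))
  have h5 : bitLength 1 = 1 := by simp [bitLength]
  simp only [Finset.sum_const, Finset.card_univ, Fintype.card_fin, smul_eq_mul] at h2
  simp only [truncSum, size, Finset.univ_unique, Finset.sum_const, Finset.card_singleton,
    one_smul, h5]
  omega

/-- Girth `m + 1` counts `m` bits and the constant for position `0`; precision `m + 1` is needed
because `k` may equal `2 ^ m`. The bits are read off references, so only one level of counting is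
added. -/
theorem Bounded.truncSum {n : ℕ} {env : ℕ → ℕ} {D m : ℕ} (hm : 1 ≤ m) {idx : S → ℕ}
    (hidx : ∀ u, idx u < n) (hD : ∀ u, env (idx u) ≤ D) {z : S} {f : S → ℕ}
    (hf : ∀ u, f u < 2 ^ m) {k : ℕ} (hk : k ≤ 2 ^ m) :
    Bounded n env (D + 1) (m + 1) (truncSum m idx z f k : CRaspFormula σ) := by
  have hb : ∀ b, Bounded n env D (m + 1) (stateBit idx f b : CRaspFormula σ) := fun b =>
    .bigDisj (by omega) fun u => .guarded (by omega) (.ref (hidx u) (hD u))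
  have h3 : bitLength (f z) ≤ m := bitLength_le_of_lt hm (hf z)
  have h4 : bitLength k ≤ m + 1 :=
    bitLength_le_of_lt (by omega) (hk.trans_lt (Nat.pow_lt_pow_right (by norm_num) (by omega)))
  have h5 : bitLength 1 = 1 := by simp [bitLength]
  refine ⟨fun t => (hb t).refs, ?_, ?_, ?_⟩
  · exact Finset.sup_le fun t _ => Nat.succ_le_succ (hb t).depth_le
  · refine max_le (Finset.sup_le fun t _ => max_le ?_ (hb t).precision_le)
      (max_le (Finset.sup_le fun t _ => max_le ?_ ?_) h4)
    · rw [bitLength_two_pow]; omega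
    · rw [h5]; omega
    · exact h3.trans (by omega)
  · exact max_le le_rfl (Finset.sup_le fun t _ => (hb t).girth_le)

theorem sat_truncSum {w : List σ} {env : ℕ → ℕ → Prop} {idx : S → ℕ} {h : ℕ → S} {i : ℕ}
    (henv : ∀ j ≤ i, ∀ u, env (idx u) j ↔ h j = u) {m : ℕ} {z : S} (hz : h 0 = z) {f : S → ℕ}
    (hf : ∀ u, f u < 2 ^ m) {k : ℕ} (hk : k ≤ 2 ^ m) :
    (truncSum m idx z f k).Sat w env i ↔ min (∑ j ∈ Finset.range (i + 1), f (h j)) (2 ^ m) = k := by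
  classical
  have hbit : ∀ j ≤ i, ∀ b, (stateBit idx f b).Sat w env j ↔ (f (h j)).testBit b = true := by
    intro j hj b
    simp only [stateBit, sat_bigDisj, sat_guarded, sat_ref, henv j hj]
    constructor
    · rintro ⟨u, h1, rfl⟩; exact h1
    · intro h1; exact ⟨_, h1, rfl⟩
  have hsum : ∑ t : Fin m, 2 ^ (t : ℕ) * ((Finset.Icc 1 i).filter
        fun j => (stateBit idx f t).Sat w env j).card + f z
      = ∑ j ∈ Finset.range (i + 1), f (h j) := by
    -- The counts range over positions from `1` on; the term of position `0` is split off and is the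
    -- constant `f z`.
    rw [Finset.sum_range_succ', hz]
    congr 1
    have h1 : ∀ t : Fin m, 2 ^ (t : ℕ) * ((Finset.Icc 1 i).filter
        fun j => (stateBit idx f t).Sat w env j).card
        = ∑ j ∈ Finset.range i, 2 ^ (t : ℕ) * (if (f (h (j + 1))).testBit t then 1 else 0) := by
      intro t
      rw [← Finset.mul_sum, Finset.card_filter]
      congr 1
      rw [Finset.range_eq_Ico, Finset.sum_Ico_add' (fun j => if (f (h j)).testBit t then 1 else 0)]
      refine Finset.sum_congr rfl fun j hj => ?_
      simp only [hbit j (by simp at hj; omega) t]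
    -- Exchanging bits and positions leaves the binary expansion of one value at each position.
    rw [Finset.sum_congr rfl fun t _ => h1 t, Finset.sum_comm]
    refine Finset.sum_congr rfl fun j _ => ?_
    exact (Finset.sum_range fun b =>
      2 ^ b * (if (f (h (j + 1))).testBit b then 1 else 0)).symm.trans (sum_two_pow_testBit m _ (hf _))
  have h2 : (truncSum m idx z f k).Sat w env i ↔ (if k < 2 ^ m then CmpRel.eq else .ge).Holds
      (∑ j ∈ Finset.range (i + 1), f (h j)) k := by
    rw [← hsum]
    simp [truncSum, Sat]
  rw [h2]
  -- Below the cap truncation changes nothing, so equality is tested; at `k = 2 ^ m` the truncated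
  -- value is reached by every larger sum.
  split_ifs with h3
  · simp only [CmpRel.Holds]; omega
  · simp only [CmpRel.Holds]; omega

end CRaspFormula

/-! ### Evaluation of programs line by line. -/

namespace CRaspFormula

variable {σ : Type u}

theorem sat_congr {w : List σ} {env env' : ℕ → ℕ → Prop} {n : ℕ} (h : ∀ j < n, env j = env' j)
    (φ : CRaspFormula σ) (hφ : φ.RefsBelow n) : φ.Sat w env = φ.Sat w env' := by
  induction φ with
  | sym a => rfl
  | ref j => funext i; simp [Sat, h j hφ]
  | neg φ ih => funext i; simp [Sat, ih hφ]
  | conj φ ψ ih ih' => funext i; simp [Sat, ih hφ.1, ih' hφ.2]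
  | compare m a φ l b c r k ih =>
    funext i
    refine congrArg (fun x => r.Holds (x + _) k) (Finset.sum_congr rfl fun t _ => ?_)
    rw [ih t (hφ t)]

theorem depth_congr {env env' : ℕ → ℕ} {n : ℕ} (h : ∀ j < n, env j = env' j)
    (φ : CRaspFormula σ) (hφ : φ.RefsBelow n) : φ.depth env = φ.depth env' := by
  induction φ with
  | sym a => rfl
  | ref j => exact h j hφ
  | neg φ ih => exact ih hφ
  | conj φ ψ ih ih' => simp [depth, ih hφ.1, ih' hφ.2]
  | compare m a φ l b c r k ih => simp only [depth, ih _ (hφ _)]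

end CRaspFormula

namespace CRaspProgram

open CRaspFormula

variable {σ : Type u} {β : Type*}

theorem run_append (f : (ℕ → β) → CRaspFormula σ → β) (n : ℕ) (env : ℕ → β)
    (l l' : List (CRaspFormula σ)) :
    run f n env (l ++ l') = run f (n + l.length) (run f n env l) l' := by
  induction l generalizing n env with
  | nil => rfl
  | cons φ l ih =>
    simp only [List.cons_append, run, ih, List.length_cons]
    congr 1; omega

theorem run_of_lt (f : (ℕ → β) → CRaspFormula σ → β) {n : ℕ} (env : ℕ → β)
    (l : List (CRaspFormula σ)) {j : ℕ} (hj : j < n) : run f n env l j = env j := by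
  induction l generalizing n env with
  | nil => rfl
  | cons φ l ih =>
    simp only [run]
    rw [ih _ (by omega), Function.update_of_ne (by omega)]

/-- The lines of a block refer only to lines before the block, so the updates made inside it are
invisible to them and all can be evaluated in the initial environment. The offset `k` makes the
induction go through. -/
theorem run_block {f : (ℕ → β) → CRaspFormula σ → β} {n : ℕ}
    (hf : ∀ (env env' : ℕ → β) (φ : CRaspFormula σ), (∀ j < n, env j = env' j) → φ.RefsBelow n →
      f env φ = f env' φ) (k : ℕ) (env : ℕ → β) (l : List (CRaspFormula σ))
    (hl : ∀ φ ∈ l, φ.RefsBelow n) (j : ℕ) (hj : j < l.length) :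
    run f (n + k) env l (n + k + j) = f env l[j] := by
  induction l generalizing k env j with
  | nil => simp at hj
  | cons φ l ih =>
    simp only [run]
    cases j with
    | zero => rw [run_of_lt _ _ _ (by omega)]; simp
    | succ j =>
      have := ih (k + 1) (Function.update env (n + k) (f env φ))
        (fun ψ hψ => hl ψ (by simp [hψ])) j (by simpa using hj)
      rw [show n + k + (j + 1) = n + (k + 1) + j by omega, show n + k + 1 = n + (k + 1) by omega,
        this]
      refine hf _ _ _ (fun i hi => Function.update_of_ne (by omega) _ _) (hl _ (by simp))

theorem run_of_length_le (f : (ℕ → β) → CRaspFormula σ → β) {n : ℕ} (env : ℕ → β)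
    (l : List (CRaspFormula σ)) {j : ℕ} (hj : n + l.length ≤ j) : run f n env l j = env j := by
  induction l generalizing n env with
  | nil => rfl
  | cons φ l ih =>
    simp only [List.length_cons] at hj
    simp only [run]
    rw [ih _ (by omega), Function.update_of_ne (by omega)]

/-- The positions at which the lines of a list hold. -/
noncomputable def listHolds (l : List (CRaspFormula σ)) (w : List σ) : ℕ → ℕ → Prop :=
  run (fun env φ i => φ.Sat w env i) 0 (fun _ _ => False) l

/-- The counting depths of the lines of a list. -/
def listDepth (l : List (CRaspFormula σ)) : ℕ → ℕ :=
  run (fun env φ => φ.depth env) 0 (fun _ => 0) l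

/-- A list of lines is admissible if all references are to earlier lines, the size is at most `B`,
the depth of every line is at most `D`, and precision and girth are at most `q`. -/
structure Admissible (l : List (CRaspFormula σ)) (B D q : ℕ) : Prop where
  refs_lt : ∀ (i : ℕ) (h : i < l.length), (l[i]).RefsBelow i
  size_le : (l.map CRaspFormula.size).sum ≤ B
  depth_le : ∀ j, listDepth l j ≤ D
  precision_le : ∀ φ ∈ l, φ.precision ≤ q
  girth_le : ∀ φ ∈ l, φ.girth ≤ q

theorem RefsBelow.mono {n m : ℕ} (h : n ≤ m) {φ : CRaspFormula σ} (hφ : φ.RefsBelow n) :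
    φ.RefsBelow m := by
  induction φ with
  | sym a => trivial
  | ref j => exact lt_of_lt_of_le hφ h
  | neg φ ih => exact ih hφ
  | conj φ ψ ih ih' => exact ⟨ih hφ.1, ih' hφ.2⟩
  | compare m a φ l b c r k ih => exact fun t => ih t (hφ t)

theorem listHolds_append_add {l l' : List (CRaspFormula σ)} {w : List σ}
    (hl' : ∀ φ ∈ l', φ.RefsBelow l.length) {j : ℕ} (hj : j < l'.length) :
    listHolds (l ++ l') w (l.length + j) = fun i => l'[j].Sat w (listHolds l w) i := by
  have := run_block (f := fun env φ i => φ.Sat w env i) (n := l.length)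
    (fun env env' φ h hφ => sat_congr h φ hφ) 0 (listHolds l w) l' hl' j hj
  rw [listHolds, run_append, zero_add]
  exact this

theorem Admissible.append {l l' : List (CRaspFormula σ)} {B B' D D' q : ℕ}
    (h : Admissible l B D q) (hD : D ≤ D')
    (hl' : ∀ φ ∈ l', Bounded l.length (listDepth l) D' q φ)
    (hB : (l'.map CRaspFormula.size).sum ≤ B') : Admissible (l ++ l') (B + B') D' q where
  refs_lt i hi := by
    rcases lt_or_ge i l.length with h1 | h1
    · rw [List.getElem_append_left h1]; exact h.refs_lt i h1
    · rw [List.getElem_append_right h1]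
      exact RefsBelow.mono h1 (hl' _ (List.getElem_mem _)).refs
  size_le := by
    rw [List.map_append, List.sum_append]; exact add_le_add h.size_le hB
  depth_le j := by
    rw [listDepth, run_append, zero_add]
    rcases lt_or_ge j l.length with h1 | h1
    · rw [run_of_lt _ _ _ h1]; exact (h.depth_le j).trans hD
    · obtain ⟨k, rfl⟩ := Nat.exists_eq_add_of_le h1
      rcases lt_or_ge k l'.length with h2 | h2
      · have := run_block (f := fun env (φ : CRaspFormula σ) => φ.depth env) (n := l.length)
          (fun env env' φ h hφ => depth_congr h φ hφ) 0 (listDepth l) l'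
          (fun φ hφ => (hl' φ hφ).refs) k h2
        rw [add_zero] at this
        exact this.trans_le (hl' _ (List.getElem_mem _)).depth_le
      · rw [run_of_length_le _ _ _ (by omega)]; exact (h.depth_le _).trans hD
  precision_le φ hφ := by
    rcases List.mem_append.1 hφ with h1 | h1
    · exact h.precision_le φ h1
    · exact (hl' φ h1).precision_le
  girth_le φ hφ := by
    rcases List.mem_append.1 hφ with h1 | h1
    · exact h.girth_le φ h1
    · exact (hl' φ h1).girth_le

theorem Admissible.nil (B D q : ℕ) : Admissible ([] : List (CRaspFormula σ)) B D q := by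
  constructor <;> simp [listDepth, run]

theorem foldr_max_le {α : Type*} {l : List α} {f : α → ℕ} {q : ℕ} (h : ∀ x ∈ l, f x ≤ q) :
    (l.map f).foldr max 0 ≤ q := by
  induction l with
  | nil => simp
  | cons a l ih => exact max_le (h a (by simp)) (ih fun x hx => h x (by simp [hx]))

/-- An admissible list of lines, followed by an output line, is a program. -/
theorem exists_of_admissible {l : List (CRaspFormula σ)} {B D q : ℕ} (h : Admissible l B D q)
    {φ : CRaspFormula σ} (hφ : Bounded l.length (listDepth l) D q φ) :
    ∃ P : CRaspProgram σ, (∀ w i, P.Holds w i ↔ φ.Sat w (listHolds l w) i) ∧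
      P.size ≤ B + φ.size ∧ P.depth ≤ D ∧ P.precision ≤ q ∧ P.girth ≤ q := by
  have h1 : Admissible (l ++ [φ]) (B + φ.size) D q :=
    h.append le_rfl (by simpa using hφ) (by simp)
  refine ⟨⟨l ++ [φ], by simp, h1.refs_lt⟩, fun w i => ?_, h1.size_le, ?_, ?_, ?_⟩
  · have := listHolds_append_add (l := l) (l' := [φ]) (w := w) (by simpa using hφ.refs)
      (j := 0) (by simp)
    have h2 := congrFun this i
    simp only [List.getElem_cons_zero] at h2
    rw [← h2]
    simp [Holds, lineHolds, listHolds]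
  · exact Finset.sup_le fun j _ => h1.depth_le j
  · exact foldr_max_le (h1.precision_le)
  · exact foldr_max_le (h1.girth_le)

/-- The list `l` of lines computes, on every string, the states `H w` of its positions: line `idx u`
holds at the positions with the state `u`. -/
def Computes {S : Type*} (l : List (CRaspFormula σ)) (idx : S → ℕ)
    (H : ∀ w : List σ, Fin (w.length + 1) → S) : Prop :=
  (∀ u, idx u < l.length) ∧ ∀ w (i : Fin (w.length + 1)) u, listHolds l w (idx u) i ↔ H w i = u

/-- The induction step of the construction: a block with one line for each state is appended, every
line of it being expressed through the earlier lines. -/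
theorem exists_append_computes {S : Type*} [Fintype S] {l : List (CRaspFormula σ)}
    {B D D' q Z : ℕ} (h : Admissible l B D q) (hD : D ≤ D') (F : S → CRaspFormula σ)
    (hF : ∀ u, Bounded l.length (listDepth l) D' q (F u)) (hZ : ∀ u, (F u).size ≤ Z)
    (H : ∀ w : List σ, Fin (w.length + 1) → S)
    (hH : ∀ w (i : Fin (w.length + 1)) u, (F u).Sat w (listHolds l w) i ↔ H w i = u) :
    ∃ l' idx, Admissible l' (B + Fintype.card S * Z) D' q ∧ Computes l' idx H := by
  let e := Fintype.equivFin S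
  let l' := List.ofFn fun k => F (e.symm k)
  have hl' : ∀ φ ∈ l', Bounded l.length (listDepth l) D' q φ := by
    intro φ hφ
    obtain ⟨k, rfl⟩ := (List.mem_ofFn' _ _).1 hφ
    exact hF _
  have hlen : l'.length = Fintype.card S := by simp [l']
  refine ⟨l ++ l', fun u => l.length + e u, h.append hD hl' ?_, fun u => ?_, fun w i u => ?_⟩
  · have : (l'.map CRaspFormula.size).sum ≤ (l'.map CRaspFormula.size).length • Z :=
      List.sum_le_card_nsmul _ _ fun x hx => by
        obtain ⟨φ, hφ, rfl⟩ := List.mem_map.1 hx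
        obtain ⟨k, rfl⟩ := (List.mem_ofFn' _ _).1 hφ
        exact hZ _
    simpa [hlen] using this
  · simp [hlen]
  · rw [listHolds_append_add (fun φ hφ => (hl' φ hφ).refs) (by rw [hlen]; exact (e u).2)]
    simp [l', hH]

end CRaspProgram

/-! ### Fixed-precision numbers as integer numerators. -/

namespace FixedNum

variable {p s : ℕ}

/-- Fixed-precision numbers correspond to the integers of an interval. -/
noncomputable def equivIco (p s : ℕ) :
    FixedNum p s ≃ Finset.Ico (-(2 : ℤ) ^ (p - 1)) (2 ^ (p - 1)) where
  toFun x := ⟨x.mant, Finset.mem_Ico.2 ⟨x.lower, x.upper⟩⟩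
  invFun m := ⟨m.1, (Finset.mem_Ico.1 m.2).1, (Finset.mem_Ico.1 m.2).2⟩
  left_inv _ := rfl
  right_inv _ := rfl

noncomputable instance : Fintype (FixedNum p s) := Fintype.ofEquiv _ (equivIco p s).symm

theorem card_eq (hp : 1 ≤ p) : Fintype.card (FixedNum p s) = 2 ^ p := by
  obtain ⟨p, rfl⟩ := Nat.exists_eq_add_of_le' hp
  rw [Fintype.card_congr (equivIco _ s), Fintype.card_coe, Int.card_Ico, Nat.add_sub_cancel]
  have : (2 : ℤ) ^ p - -2 ^ p = ((2 ^ (p + 1) : ℕ) : ℤ) := by push_cast; ring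
  rw [this, Int.toNat_natCast]

/-- For nonnegative arguments the lower clip is inactive, so rounding is a capped natural floor. -/
theorem round_mant_of_nonneg {x : ℝ} (hx : 0 ≤ x) :
    (round p s x).mant = ((min (2 ^ (p - 1) - 1) ⌊x * 2 ^ s⌋₊ : ℕ) : ℤ) := by
  have h1 : (0 : ℤ) < 2 ^ (p - 1) := by positivity
  have h2 : 0 ≤ x * 2 ^ s := by positivity
  have h3 : ((2 ^ (p - 1) - 1 : ℕ) : ℤ) = 2 ^ (p - 1) - 1 := by
    rw [Nat.cast_sub Nat.one_le_two_pow]; push_cast; rfl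
  simp only [round]
  rw [Nat.cast_min, h3, Int.natCast_floor_eq_floor h2, max_eq_right]
  exact le_min (by omega) ((by omega : -(2 : ℤ) ^ (p - 1) ≤ 0).trans (Int.floor_nonneg.2 h2))

theorem toReal_round_of_nonneg {x : ℝ} (hx : 0 ≤ x) :
    (round p s x).toReal = ((min (2 ^ (p - 1) - 1) ⌊x * 2 ^ s⌋₊ : ℕ) : ℝ) / 2 ^ s := by
  rw [toReal, round_mant_of_nonneg hx, Int.cast_natCast]

end FixedNum

theorem FixedVec.card_eq {p s d : ℕ} (hp : 1 ≤ p) :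
    Fintype.card (FixedVec p s d) = 2 ^ (p * d) := by
  rw [Fintype.card_fun, FixedNum.card_eq hp, Fintype.card_fin, pow_mul]

/-! ### Attention in natural-number arithmetic. -/

namespace TransformerLayer

open FixedNum

variable {p s d n : ℕ} (Λ : TransformerLayer p s d)

/-- The numerator of the attention score of a position with state `v` for one with state `u`. -/
noncomputable def scoreNat (v u : FixedVec p s d) : ℕ :=
  min (2 ^ (p - 1) - 1)
    ⌊Real.exp (∑ c, (Λ.query v c).toReal * (Λ.key u c).toReal) * 2 ^ s⌋₊

/-- The numerator of the attention weight of a position whose score is `a`, if the sum of the scores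
is `N` and the number of positions is `M`. -/
def weightNat (p s N M a : ℕ) : ℕ :=
  min (2 ^ (p - 1) - 1) (if N = 0 then 2 ^ s / M else a * 2 ^ s / N)

/-- The numerator of the positive part of the summand that a position with state `u` contributes to
coordinate `c` of the attention of a position with state `v`. -/
noncomputable def posPart (N M : ℕ) (v : FixedVec p s d) (c : Fin d) (u : FixedVec p s d) : ℕ :=
  weightNat p s N M (Λ.scoreNat v u) * (Λ.value u c).mant.toNat

/-- The numerator of the negative part of the summand that a position with state `u` contributes to
coordinate `c` of the attention of a position with state `v`. -/
noncomputable def negPart (N M : ℕ) (v : FixedVec p s d) (c : Fin d) (u : FixedVec p s d) : ℕ :=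
  weightNat p s N M (Λ.scoreNat v u) * (-(Λ.value u c).mant).toNat

theorem scoreNat_lt (v u : FixedVec p s d) : Λ.scoreNat v u < 2 ^ (p - 1) :=
  (min_le_left _ _).trans_lt (Nat.sub_lt (by positivity) one_pos)

theorem weightNat_lt (p s N M a : ℕ) : weightNat p s N M a < 2 ^ (p - 1) :=
  (min_le_left _ _).trans_lt (Nat.sub_lt (by positivity) one_pos)

theorem score_eq (h : Fin n → FixedVec p s d) (i j : Fin n) :
    Λ.score h i j = (Λ.scoreNat (h i) (h j) : ℝ) / 2 ^ s :=
  toReal_round_of_nonneg (Real.exp_pos _).le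

theorem denom_eq (h : Fin n → FixedVec p s d) (i : Fin n) :
    Λ.denom h i = ((∑ j ∈ Finset.Iic i, Λ.scoreNat (h i) (h j) : ℕ) : ℝ) / 2 ^ s := by
  rw [denom, Nat.cast_sum, Finset.sum_div]
  exact Finset.sum_congr rfl fun j _ => Λ.score_eq h i j

/-- The denominators `2 ^ s` of score and score sum cancel, and the floor of a real quotient of
naturals is their natural quotient. -/
theorem weight_eq (h : Fin n → FixedVec p s d) (i j : Fin n) :
    (Λ.weight h i j).toReal = (weightNat p s (∑ j ∈ Finset.Iic i, Λ.scoreNat (h i) (h j))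
      (i + 1) (Λ.scoreNat (h i) (h j)) : ℝ) / 2 ^ s := by
  have h2 : (0 : ℝ) < 2 ^ s := by positivity
  rw [weight, denom_eq, score_eq]
  generalize ∑ j ∈ Finset.Iic i, Λ.scoreNat (h i) (h j) = N
  generalize Λ.scoreNat (h i) (h j) = a
  have h3 : (N : ℝ) / 2 ^ s = 0 ↔ N = 0 := by
    rw [div_eq_zero_iff]; simp
  rw [toReal_round_of_nonneg (by split_ifs <;> positivity), weightNat]
  congr 3
  simp only [h3]
  split_ifs with h4
  · rw [← Nat.floor_div_eq_div (K := ℝ)]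
    congr 1; push_cast; ring
  · rw [← Nat.floor_div_eq_div (K := ℝ)]
    congr 1; push_cast; field_simp

/-- Weight and value each contribute a denominator `2 ^ s`; the signed mantissa of the value is
split into its positive and negative part. -/
theorem attention_eq (h : Fin n → FixedVec p s d) (i : Fin n) (c : Fin d) {N : ℕ}
    (hN : ∑ j ∈ Finset.Iic i, Λ.scoreNat (h i) (h j) = N) :
    Λ.attention h i c = round p s
      (((∑ j ∈ Finset.Iic i, Λ.posPart N (i + 1) (h i) c (h j) : ℕ) -
        (∑ j ∈ Finset.Iic i, Λ.negPart N (i + 1) (h i) c (h j) : ℕ) : ℝ) / 2 ^ s / 2 ^ s) := by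
  rw [attention]
  congr 1
  push_cast
  rw [← Finset.sum_sub_distrib, Finset.sum_div, Finset.sum_div]
  refine Finset.sum_congr rfl fun j _ => ?_
  rw [weight_eq, hN, toReal, posPart, negPart]
  have : ((Λ.value (h j) c).mant : ℝ) = ((Λ.value (h j) c).mant.toNat : ℝ)
      - ((-(Λ.value (h j) c).mant).toNat : ℝ) := by
    exact_mod_cast congrArg (Int.cast : ℤ → ℝ) (Int.toNat_sub_toNat_neg (Λ.value (h j) c).mant).symm
  rw [this]
  push_cast
  ring

theorem two_pow_bounds (hp : 1 ≤ p) : 2 * 2 ^ (p - 1) = 2 ^ p ∧ 2 ^ (2 * p) = 2 ^ p * 2 ^ p := by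
  obtain ⟨p, rfl⟩ := Nat.exists_eq_add_of_le' hp
  exact ⟨by rw [Nat.add_sub_cancel, pow_succ]; ring, by rw [two_mul, pow_add]⟩

theorem toNat_mant_le (x : FixedNum p s) :
    x.mant.toNat ≤ 2 ^ (p - 1) ∧ (-x.mant).toNat ≤ 2 ^ (p - 1) := by
  have h1 := x.lower
  have h2 := x.upper
  constructor <;> (rw [Int.toNat_le]; push_cast; omega)

theorem posPart_lt (hp : 1 ≤ p) (N M : ℕ) (v : FixedVec p s d) (c : Fin d) (u : FixedVec p s d) :
    Λ.posPart N M v c u < 2 ^ (2 * p) := by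
  obtain ⟨h1, h2⟩ := two_pow_bounds hp
  have h3 := weightNat_lt p s N M (Λ.scoreNat v u)
  have h4 := (toNat_mant_le (Λ.value u c)).1
  rw [posPart, h2]
  nlinarith [Nat.mul_le_mul h3.le h4, Nat.pow_pos (n := p - 1) (show 0 < 2 by norm_num)]

theorem negPart_lt (hp : 1 ≤ p) (N M : ℕ) (v : FixedVec p s d) (c : Fin d) (u : FixedVec p s d) :
    Λ.negPart N M v c u < 2 ^ (2 * p) := by
  obtain ⟨h1, h2⟩ := two_pow_bounds hp
  have h3 := weightNat_lt p s N M (Λ.scoreNat v u)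
  have h4 := (toNat_mant_le (Λ.value u c)).2
  rw [negPart, h2]
  nlinarith [Nat.mul_le_mul h3.le h4, Nat.pow_pos (n := p - 1) (show 0 < 2 by norm_num)]

/-- Both dividends `2 ^ s` and `a * 2 ^ s` are below `2 ^ (2 * p)`, so a divisor at or above this
cap gives quotient `0`, as the cap itself does. Truncation also preserves whether `N` is `0`. -/
theorem weightNat_min (hp : 1 ≤ p) (hs : s ≤ p) (N M a : ℕ) (ha : a < 2 ^ (p - 1)) :
    weightNat p s (min N (2 ^ (2 * p))) (min M (2 ^ (2 * p))) a = weightNat p s N M a := by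
  obtain ⟨h1, h2⟩ := two_pow_bounds hp
  have h3 : 2 ^ s ≤ 2 ^ p := Nat.pow_le_pow_right (by norm_num) hs
  have h4 : 0 < 2 ^ p := by positivity
  have h5 : ∀ x y K : ℕ, x < K → x / min y K = x / y := by
    intro x y K hx
    rcases le_total y K with h | h
    · rw [min_eq_left h]
    · rw [min_eq_right h, Nat.div_eq_of_lt hx, Nat.div_eq_of_lt (hx.trans_le h)]
  have h6 : 2 ^ s < 2 ^ (2 * p) := by
    apply Nat.pow_lt_pow_right (by norm_num); omega
  have h7 : a * 2 ^ s < 2 ^ (2 * p) := by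
    rw [h2]; nlinarith [Nat.mul_le_mul ha.le h3]
  have h8 : min N (2 ^ (2 * p)) = 0 ↔ N = 0 := by
    have : 0 < 2 ^ (2 * p) := by positivity
    omega
  simp only [weightNat, h8, h5 _ _ _ h6, h5 _ _ _ h7]

/-- Exact weights sum to at most `1`, and both flooring and capping only lower them. Hence the bound
does not grow with the length of the string. -/
theorem sum_weightNat_le {ι : Type*} (t : Finset ι) (a : ι → ℕ) :
    ∑ j ∈ t, weightNat p s (∑ j ∈ t, a j) t.card (a j) ≤ 2 ^ s := by
  have h1 : ∀ j, weightNat p s (∑ j ∈ t, a j) t.card (a j) ≤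
      if ∑ j ∈ t, a j = 0 then 2 ^ s / t.card else a j * 2 ^ s / ∑ j ∈ t, a j :=
    fun j => min_le_right _ _
  refine (Finset.sum_le_sum fun j _ => h1 j).trans ?_
  split_ifs with h
  · rw [Finset.sum_const, smul_eq_mul]; exact Nat.mul_div_le _ _
  · rw [← Nat.mul_le_mul_right_iff (Nat.pos_of_ne_zero h), Finset.sum_mul]
    refine (Finset.sum_le_sum fun j _ => Nat.div_mul_le_self _ _).trans ?_
    rw [← Finset.sum_mul, mul_comm]

/-- Total weight at most `2 ^ s` times mantissas at most `2 ^ (p - 1)` stays below the cap, so these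
sums are tested exactly although the test truncates. -/
theorem sum_posPart_lt (hp : 1 ≤ p) (hs : s ≤ p) (h : Fin n → FixedVec p s d) (i : Fin n)
    (c : Fin d) {N : ℕ} (hN : ∑ j ∈ Finset.Iic i, Λ.scoreNat (h i) (h j) = N) :
    ∑ j ∈ Finset.Iic i, Λ.posPart N (i + 1) (h i) c (h j) < 2 ^ (2 * p) ∧
    ∑ j ∈ Finset.Iic i, Λ.negPart N (i + 1) (h i) c (h j) < 2 ^ (2 * p) := by
  obtain ⟨h1, h2⟩ := two_pow_bounds hp
  have h3 : 2 ^ s ≤ 2 ^ p := Nat.pow_le_pow_right (by norm_num) hs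
  have h5 := sum_weightNat_le (p := p) (s := s) (Finset.Iic i)
    fun j => Λ.scoreNat (h i) (h j)
  rw [hN, Fin.card_Iic] at h5
  have h6 : 2 ^ s * 2 ^ (p - 1) < 2 ^ (2 * p) := by
    rw [h2]
    nlinarith [Nat.pow_pos (n := p - 1) (show 0 < 2 by norm_num),
      Nat.mul_le_mul_right (2 ^ (p - 1)) h3]
  have h7 := Nat.mul_le_mul_right (2 ^ (p - 1)) h5
  rw [Finset.sum_mul] at h7
  constructor
  · exact ((Finset.sum_le_sum fun j _ => Nat.mul_le_mul_left _ (toNat_mant_le _).1).trans h7).trans_lt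
      h6
  · exact ((Finset.sum_le_sum fun j _ => Nat.mul_le_mul_left _ (toNat_mant_le _).2).trans h7).trans_lt
      h6

/-- With one bit, attention does not depend on the other positions. -/
theorem apply_one_bit (Λ : TransformerLayer 1 s d) (h : Fin n → FixedVec 1 s d) (i : Fin n) :
    Λ.apply h i = Λ.ff fun c => round 1 s ((round 1 s 0).toReal + (h i c).toReal) := by
  have : ∀ j, (Λ.weight h i j).toReal = 0 := by
    intro j
    -- For `p = 1` the largest number is `0`: the cap `2 ^ (p - 1) - 1` vanishes.
    rw [weight_eq]; simp [weightNat]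
  simp [apply, attention, this]

/-- By future masking the first position attends only to itself. So its state is the same for all
words, which the constant summand of `truncSum` requires. -/
theorem apply_zero (h : Fin (n + 1) → FixedVec p s d) :
    Λ.apply h 0 = Λ.apply (fun _ : Fin 1 => h 0) 0 := by
  have : Finset.Iic (0 : Fin (n + 1)) = {0} := by
    ext j; simp
  simp [apply, attention, weight, denom, score, this]

end TransformerLayer

/-! ### Formulas for one layer. -/

theorem Fin.sum_Iic_eq_sum_range {n : ℕ} (f : Fin (n + 1) → ℕ) (i : Fin (n + 1)) :
    ∑ j ∈ Finset.Iic i, f j = ∑ j ∈ Finset.range (i + 1), f (Fin.ofNat (n + 1) j) := by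
  have h := Finset.sum_map (Finset.Iic i) Fin.valEmbedding fun j => f (Fin.ofNat (n + 1) j)
  rw [Fin.map_valEmbedding_Iic] at h
  rw [Nat.range_succ_eq_Iic, h]
  refine Finset.sum_congr rfl fun j _ => ?_
  simp

namespace CRaspFormula

open CRaspProgram FixedNum TransformerLayer

variable {σ : Type u}

theorem sat_truncSum_of_computes {S : Type*} [Fintype S] {l : List (CRaspFormula σ)} {idx : S → ℕ}
    {H : ∀ w : List σ, Fin (w.length + 1) → S} (hc : Computes l idx H) {z : S} (w : List σ)
    (hz : H w 0 = z) {m : ℕ} {f : S → ℕ} (hf : ∀ u, f u < 2 ^ m) {k : ℕ} (hk : k ≤ 2 ^ m)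
    (i : Fin (w.length + 1)) :
    (truncSum m idx z f k).Sat w (listHolds l w) i ↔
      min (∑ j ∈ Finset.Iic i, f (H w j)) (2 ^ m) = k := by
  rw [Fin.sum_Iic_eq_sum_range]
  refine sat_truncSum (h := fun j => H w (Fin.ofNat (w.length + 1) j))
    (fun j hj u => ?_) (by simpa using hz) hf hk
  have hj' : j < w.length + 1 := hj.trans_lt i.2
  have h1 := hc.2 w (Fin.ofNat (w.length + 1) j) u
  simpa [Nat.mod_eq_of_lt hj'] using h1

section Layer

variable {p s d : ℕ} (Λ : TransformerLayer p s d) (idx : FixedVec p s d → ℕ) (z : FixedVec p s d)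

/-- The formula saying that the attention of a position with state `v` is `a`. -/
noncomputable def attentionFormula (v a : FixedVec p s d) : CRaspFormula σ :=
  bigDisj fun x : Fin (2 ^ (2 * p) + 1) × Fin (2 ^ (2 * p) + 1) =>
    ((truncSum (2 * p) idx z (Λ.scoreNat v) x.1).conj
      (truncSum (2 * p) idx z (fun _ => 1) x.2)).conj
    (bigConj fun c => bigDisj fun y : Fin (2 ^ (2 * p) + 1) × Fin (2 ^ (2 * p) + 1) =>
      guarded (round p s ((((y.1 : ℕ) : ℝ) - ((y.2 : ℕ) : ℝ)) / 2 ^ s / 2 ^ s) = a c)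
        ((truncSum (2 * p) idx z (Λ.posPart x.1 x.2 v c) y.1).conj
          (truncSum (2 * p) idx z (Λ.negPart x.1 x.2 v c) y.2)))

/-- The formula saying that the state after the layer is `v`. -/
noncomputable def layerFormula (v : FixedVec p s d) : CRaspFormula σ :=
  bigDisj fun x : FixedVec p s d × FixedVec p s d =>
    guarded (Λ.ff (fun c => round p s ((x.2 c).toReal + (x.1 c).toReal)) = v)
      ((ref (idx x.1)).conj (attentionFormula Λ idx z x.1 x.2))

variable {Λ idx z}

theorem scoreNat_lt_two_pow (v u : FixedVec p s d) : Λ.scoreNat v u < 2 ^ (2 * p) :=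
  (scoreNat_lt Λ v u).trans_le (Nat.pow_le_pow_right (by norm_num) (by omega))

theorem one_lt_two_pow_two_mul (hp : 1 ≤ p) : 1 < 2 ^ (2 * p) :=
  Nat.one_lt_two_pow (by omega)

/-- The outer guess is forced to be the truncated score sum and position count; these determine all
weights, and with them the inner guesses are forced to be the positive and negative sums of each
coordinate. -/
theorem sat_attentionFormula (hp : 1 ≤ p) (hs : s ≤ p) {l : List (CRaspFormula σ)}
    {H : ∀ w : List σ, Fin (w.length + 1) → FixedVec p s d} (hc : Computes l idx H) (w : List σ)
    (hz : H w 0 = z) (i : Fin (w.length + 1)) (a : FixedVec p s d) :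
    (attentionFormula Λ idx z (H w i) a).Sat w (listHolds l w) i ↔ Λ.attention (H w) i = a := by
  have hle : ∀ x : Fin (2 ^ (2 * p) + 1), (x : ℕ) ≤ 2 ^ (2 * p) := fun x => Nat.lt_succ_iff.1 x.2
  generalize hN : ∑ j ∈ Finset.Iic i, Λ.scoreNat (H w i) (H w j) = N
  -- The formula knows only truncated values of `N` and `i + 1`; the weights do not see the
  -- difference.
  have hpos : ∀ c u, Λ.posPart (min N (2 ^ (2 * p))) (min (i + 1) (2 ^ (2 * p))) (H w i) c u
      = Λ.posPart N (i + 1) (H w i) c u := fun c u => by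
    rw [TransformerLayer.posPart, TransformerLayer.posPart,
      weightNat_min hp hs _ _ _ (Λ.scoreNat_lt _ _)]
  have hneg : ∀ c u, Λ.negPart (min N (2 ^ (2 * p))) (min (i + 1) (2 ^ (2 * p))) (H w i) c u
      = Λ.negPart N (i + 1) (H w i) c u := fun c u => by
    rw [TransformerLayer.negPart, TransformerLayer.negPart,
      weightNat_min hp hs _ _ _ (Λ.scoreNat_lt _ _)]
  simp only [attentionFormula, sat_bigDisj, sat_conj, sat_bigConj, sat_guarded, Prod.exists,
    sat_truncSum_of_computes hc w hz (scoreNat_lt_two_pow _) (hle _),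
    sat_truncSum_of_computes hc w hz (fun _ => one_lt_two_pow_two_mul hp) (hle _),
    sat_truncSum_of_computes hc w hz (Λ.posPart_lt hp _ _ _ _) (hle _),
    sat_truncSum_of_computes hc w hz (Λ.negPart_lt hp _ _ _ _) (hle _), hN,
    Finset.sum_const, Fin.card_Iic, smul_eq_mul, mul_one]
  have step : ∀ c, (∃ P M : Fin (2 ^ (2 * p) + 1),
      round p s ((((P : ℕ) : ℝ) - ((M : ℕ) : ℝ)) / 2 ^ s / 2 ^ s) = a c ∧
      min (∑ j ∈ Finset.Iic i, Λ.posPart (min N (2 ^ (2 * p))) (min (i + 1) (2 ^ (2 * p))) (H w i) c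
        (H w j)) (2 ^ (2 * p)) = P ∧
      min (∑ j ∈ Finset.Iic i, Λ.negPart (min N (2 ^ (2 * p))) (min (i + 1) (2 ^ (2 * p))) (H w i) c
        (H w j)) (2 ^ (2 * p)) = M) ↔ Λ.attention (H w) i c = a c := by
    intro c
    obtain ⟨h1, h2⟩ := Λ.sum_posPart_lt hp hs (H w) i c hN
    simp only [hpos, hneg]
    rw [min_eq_left h1.le, min_eq_left h2.le, Λ.attention_eq (H w) i c hN]
    constructor
    · rintro ⟨P, M, h3, h4, h5⟩; rw [← h3, h4, h5]
    · intro h3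
      exact ⟨⟨_, h1.trans (Nat.lt_succ_self _)⟩, ⟨_, h2.trans (Nat.lt_succ_self _)⟩, h3, rfl, rfl⟩
  constructor
  · rintro ⟨x, y, ⟨hx, hy⟩, h⟩
    funext c
    rw [← step c]
    simpa only [hx, hy] using h c
  · intro h
    refine ⟨⟨_, Nat.lt_succ_iff.2 (min_le_right N _)⟩,
      ⟨_, Nat.lt_succ_iff.2 (min_le_right ((i : ℕ) + 1) _)⟩,
      ⟨rfl, rfl⟩, fun c => (step c).2 (congrFun h c)⟩

theorem sat_layerFormula (hp : 1 ≤ p) (hs : s ≤ p) {l : List (CRaspFormula σ)}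
    {H : ∀ w : List σ, Fin (w.length + 1) → FixedVec p s d} (hc : Computes l idx H) (w : List σ)
    (hz : H w 0 = z) (i : Fin (w.length + 1)) (v : FixedVec p s d) :
    (layerFormula Λ idx z v).Sat w (listHolds l w) i ↔ Λ.apply (H w) i = v := by
  simp only [layerFormula, sat_bigDisj, sat_guarded, sat_conj, sat_ref, hc.2, Prod.exists]
  constructor
  · rintro ⟨x, y, h1, rfl, h2⟩
    rw [sat_attentionFormula hp hs hc w hz] at h2
    rw [← h1, ← h2]; rfl
  · intro h
    exact ⟨_, _, h, rfl, (sat_attentionFormula hp hs hc w hz i _).2 rfl⟩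

theorem Bounded.layerFormula (hp : 1 ≤ p) {n : ℕ} {env : ℕ → ℕ} {D : ℕ} (hidx : ∀ u, idx u < n)
    (hD : ∀ j, env j ≤ D) (v : FixedVec p s d) :
    Bounded n env (D + 1) (2 * p + 1) (layerFormula Λ idx z v : CRaspFormula σ) := by
  have hle : ∀ x : Fin (2 ^ (2 * p) + 1), (x : ℕ) ≤ 2 ^ (2 * p) := fun x => Nat.lt_succ_iff.1 x.2
  have h2 : 1 ≤ 2 * p := by omega
  have hq : 1 ≤ 2 * p + 1 := by omega
  have hD' : ∀ u, env (idx u) ≤ D := fun u => hD _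
  refine .bigDisj hq fun x => .guarded hq (.conj (.ref (hidx _) ((hD _).trans (Nat.le_succ _)))
    (.bigDisj hq fun x => .conj (.conj ?_ ?_)
      (.bigConj hq fun c => .bigDisj hq fun y => .guarded hq (.conj ?_ ?_))))
  · exact .truncSum h2 hidx hD' (scoreNat_lt_two_pow _) (hle _)
  · exact .truncSum h2 hidx hD' (fun _ => one_lt_two_pow_two_mul hp) (hle _)
  · exact .truncSum h2 hidx hD' (Λ.posPart_lt hp _ _ _ _) (hle _)
  · exact .truncSum h2 hidx hD' (Λ.negPart_lt hp _ _ _ _) (hle _)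

/-- With `X = 2 ^ p` and `Q` states the size is at most `4 * p ^ 2 + 12 * p * Q + 12 * p + 4`, and
each monomial is at most `X ^ 2 * Q`. -/
theorem size_truncSum_two_mul_le (hp : 1 ≤ p) {f : FixedVec p s d → ℕ}
    (hf : ∀ u, f u < 2 ^ (2 * p)) (x : Fin (2 ^ (2 * p) + 1)) :
    (truncSum (2 * p) idx z f x : CRaspFormula σ).size
      ≤ 32 * (2 ^ p) ^ 2 * Fintype.card (FixedVec p s d) := by
  refine (size_truncSum_le (by omega) hf (Nat.lt_succ_iff.1 x.2)).trans ?_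
  have hQ : 1 ≤ Fintype.card (FixedVec p s d) := Fintype.card_pos_iff.2 ⟨z⟩
  have hpX : p ≤ 2 ^ p := Nat.lt_two_pow_self.le
  have hX : 1 ≤ 2 ^ p := Nat.one_le_two_pow
  generalize Fintype.card (FixedVec p s d) = Q at *
  generalize 2 ^ p = X at *
  have h1 : X ≤ X ^ 2 := by nlinarith
  have h2 : p * p ≤ X ^ 2 := by nlinarith
  have h3 : X ^ 2 ≤ X ^ 2 * Q := by nlinarith
  have h4 : p * Q ≤ X ^ 2 * Q := Nat.mul_le_mul_right Q (by omega)
  nlinarith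

/-- With `X = 2 ^ p` and `Q` states, a counting test costs `X ^ 2 * Q`, the inner and the outer
guess of a pair cost a factor `X ^ 4` each, the coordinates a factor `d`, and the choice of old
state and attention a factor `Q ^ 2`. -/
theorem size_layerFormula_le (hp : 1 ≤ p) (hd : 1 ≤ d) (v : FixedVec p s d) :
    (layerFormula Λ idx z v : CRaspFormula σ).size
      ≤ 1464 * d * (2 ^ p) ^ 10 * Fintype.card (FixedVec p s d) ^ 3 := by
  have hA {f : FixedVec p s d → ℕ} (hf : ∀ u, f u < 2 ^ (2 * p)) (x : Fin (2 ^ (2 * p) + 1)) :=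
    size_truncSum_two_mul_le (σ := σ) (idx := idx) (z := z) hp hf x
  have hQ : 1 ≤ Fintype.card (FixedVec p s d) := Fintype.card_pos_iff.2 ⟨z⟩
  have hX : 1 ≤ 2 ^ p := Nat.one_le_two_pow
  have hK : (2 ^ (2 * p) + 1) * (2 ^ (2 * p) + 1) ≤ 4 * (2 ^ p) ^ 4 := by
    have : 2 ^ (2 * p) = (2 ^ p) ^ 2 := by rw [mul_comm, pow_mul]
    rw [this]
    have : 1 ≤ (2 ^ p) ^ 2 := Nat.one_le_pow _ _ hX
    nlinarith
  have hKc : Fintype.card (Fin (2 ^ (2 * p) + 1) × Fin (2 ^ (2 * p) + 1)) ≤ 4 * (2 ^ p) ^ 4 := by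
    rw [Fintype.card_prod, Fintype.card_fin]; exact hK
  have hconj : ∀ φ ψ : CRaspFormula σ, (φ.conj ψ).size = φ.size + ψ.size + 1 := fun _ _ => rfl
  have hcard := Fintype.card_prod (FixedVec p s d) (FixedVec p s d)
  unfold layerFormula attentionFormula
  generalize Fintype.card (FixedVec p s d) = Q at *
  generalize 2 ^ p = X at *
  have one : ∀ k, 1 ≤ X ^ k * Q := fun k => Nat.mul_pos (Nat.pow_pos hX) hQ
  have inner : ∀ (x : Fin (2 ^ (2 * p) + 1) × Fin (2 ^ (2 * p) + 1)) (y a : FixedVec p s d)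
      (c : Fin d),
      (bigDisj fun y' : Fin (2 ^ (2 * p) + 1) × Fin (2 ^ (2 * p) + 1) =>
      guarded (round p s ((((y'.1 : ℕ) : ℝ) - ((y'.2 : ℕ) : ℝ)) / 2 ^ s / 2 ^ s) = a c)
        ((truncSum (2 * p) idx z (Λ.posPart x.1 x.2 y c) y'.1 : CRaspFormula σ).conj
          (truncSum (2 * p) idx z (Λ.negPart x.1 x.2 y c) y'.2))).size ≤ 284 * X ^ 6 * Q := by
    intro x y a c
    refine (size_bigDisj_le (B := 64 * X ^ 2 * Q + 1) fun y' => size_guarded_le ?_ ?_).trans ?_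
    · have := one 2; nlinarith
    · rw [hconj]
      have h1 := hA (Λ.posPart_lt hp x.1 x.2 y c) y'.1
      have h2 := hA (Λ.negPart_lt hp x.1 x.2 y c) y'.2
      linarith
    · refine (Nat.add_le_add_right (Nat.mul_le_mul_right _ hKc) 2).trans ?_
      have h1 := one 6
      have h2 : X ^ 4 ≤ X ^ 6 * Q :=
        (Nat.pow_le_pow_right hX (by norm_num)).trans (Nat.le_mul_of_pos_right _ hQ)
      have h3 : 4 * X ^ 4 * (64 * X ^ 2 * Q + 1 + 4) + 2 = 256 * (X ^ 6 * Q) + 20 * X ^ 4 + 2 := by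
        ring
      rw [h3]
      linarith
  have att : ∀ y a : FixedVec p s d,
      (attentionFormula Λ idx z y a : CRaspFormula σ).size ≤ 1456 * d * X ^ 10 * Q := by
    intro y a
    refine (size_bigDisj_le (B := 64 * X ^ 2 * Q + 292 * d * X ^ 6 * Q + 2) fun x => ?_).trans ?_
    · rw [hconj, hconj]
      have h1 := hA (scoreNat_lt_two_pow (Λ := Λ) y) x.1
      have h2 := hA (fun _ => one_lt_two_pow_two_mul hp) x.2
      have h3 := size_bigConj_le (inner x y a)
      rw [Fintype.card_fin] at h3
      have h4 : d * (284 * X ^ 6 * Q + 5) + 3 ≤ 292 * d * X ^ 6 * Q := by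
        have h5 : d * 1 ≤ d * (X ^ 6 * Q) := Nat.mul_le_mul_left d (one 6)
        have h6 : d * (284 * X ^ 6 * Q + 5) = 284 * (d * (X ^ 6 * Q)) + 5 * d := by ring
        have h7 : 292 * d * X ^ 6 * Q = 292 * (d * (X ^ 6 * Q)) := by ring
        rw [h6, h7]; linarith
      linarith
    · refine (Nat.add_le_add_right (Nat.mul_le_mul_right _ hKc) 2).trans ?_
      have h1 : X ^ 6 * Q ≤ d * (X ^ 10 * Q) :=
        (Nat.mul_le_mul_right Q (Nat.pow_le_pow_right hX (by norm_num))).trans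
          (Nat.le_mul_of_pos_left _ hd)
      have h2 : X ^ 4 ≤ X ^ 6 * Q :=
        (Nat.pow_le_pow_right hX (by norm_num)).trans (Nat.le_mul_of_pos_right _ hQ)
      have h4 := one 6
      have h3 : 4 * X ^ 4 * (64 * X ^ 2 * Q + 292 * d * X ^ 6 * Q + 2 + 4) + 2
          = 256 * (X ^ 6 * Q) + 1168 * (d * (X ^ 10 * Q)) + 24 * X ^ 4 + 2 := by ring
      have h5 : 1456 * d * X ^ 10 * Q = 1456 * (d * (X ^ 10 * Q)) := by ring
      rw [h3, h5]
      linarith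
  refine (size_bigDisj_le (B := 1456 * d * X ^ 10 * Q + 2) fun x => size_guarded_le ?_ ?_).trans ?_
  · omega
  · rw [hconj]
    have := att x.1 x.2
    have h1 : (ref (idx x.1) : CRaspFormula σ).size = 1 := rfl
    unfold attentionFormula at this
    omega
  · rw [hcard]
    have h1 : 1 ≤ Q * Q := Nat.mul_pos hQ hQ
    have h2 : Q * Q ≤ d * X ^ 10 * Q ^ 3 := by
      calc Q * Q = 1 * (Q * Q) := (one_mul _).symm
        _ ≤ (d * X ^ 10 * Q) * (Q * Q) :=
          Nat.mul_le_mul_right _ (Nat.mul_pos (Nat.mul_pos hd (Nat.pow_pos hX)) hQ)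
        _ = d * X ^ 10 * Q ^ 3 := by ring
    have h3 : Q * Q * (1456 * d * X ^ 10 * Q + 2 + 4) + 2
        = 1456 * (d * X ^ 10 * Q ^ 3) + 6 * (Q * Q) + 2 := by ring
    have h4 : 1464 * d * X ^ 10 * Q ^ 3 = 1464 * (d * X ^ 10 * Q ^ 3) := by ring
    rw [h3, h4]
    linarith

end Layer

/-! ### The embedding layer. -/

/-- The formula saying that the current symbol, which is `none` at position `0`, satisfies `g`. -/
noncomputable def symbolFormula [Fintype σ] (g : Option σ → Prop) : CRaspFormula σ :=
  disj (bigDisj fun a => guarded (g (some a)) (sym a)) (guarded (g none) (neg (bigDisj sym)))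

theorem sat_sym_iff (w : List σ) (env : ℕ → ℕ → Prop) (i : Fin (w.length + 1)) (a : σ) :
    (sym a).Sat w env i ↔ withBOS w i = some a := by
  cases i using Fin.cases with
  | zero => simp [Sat, withBOS]
  | succ i => simp [Sat, withBOS]

/-- Position `0`, which carries the beginning-of-string symbol, is recognized as the only one where
no symbol of the alphabet holds. -/
theorem sat_symbolFormula [Fintype σ] (g : Option σ → Prop) (w : List σ) (env : ℕ → ℕ → Prop)
    (i : Fin (w.length + 1)) : (symbolFormula g).Sat w env i ↔ g (withBOS w i) := by
  simp only [symbolFormula, sat_disj, sat_bigDisj, sat_guarded, sat_neg, sat_sym_iff]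
  cases withBOS w i <;> simp

theorem Bounded.symbolFormula [Fintype σ] {n : ℕ} {env : ℕ → ℕ} {D q : ℕ} (hq : 1 ≤ q)
    (g : Option σ → Prop) : Bounded n env D q (symbolFormula g) :=
  .disj (.bigDisj hq fun a => .guarded hq (.sym a)) (.guarded hq (.neg (.bigDisj hq .sym)))

theorem size_symbolFormula_le [Fintype σ] [Nonempty σ] (g : Option σ → Prop) :
    (symbolFormula g).size ≤ 20 * Fintype.card σ := by
  have h1 : (bigDisj fun a => guarded (g (some a)) (sym a)).size ≤ Fintype.card σ * (2 + 4) + 2 :=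
    size_bigDisj_le fun a => size_guarded_le le_rfl (by simp [size])
  have h2 : (bigDisj (sym : σ → _)).size ≤ Fintype.card σ * (1 + 4) + 2 :=
    size_bigDisj_le fun a => by simp [size]
  have h3 : (guarded (g none) (neg (bigDisj (sym : σ → _)))).size
      ≤ Fintype.card σ * (1 + 4) + 2 + 1 :=
    size_guarded_le (by omega) (by simpa [size] using h2)
  have h4 : (symbolFormula g).size = (bigDisj fun a => guarded (g (some a)) (sym a)).size + 1
      + ((guarded (g none) (neg (bigDisj (sym : σ → _)))).size + 1) + 1 + 1 := rfl
  have := Fintype.card_pos (α := σ)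
  omega

end CRaspFormula

/-! ### Assembly of the program. -/

namespace CRaspProgram

open CRaspFormula FixedNum

variable {σ : Type u} {p s d : ℕ}

theorem exists_computes_layers (hp : 1 ≤ p) (hs : s ≤ p) (hd : 1 ≤ d) {Z : ℕ}
    (hZ : Fintype.card (FixedVec p s d) * (1464 * d * (2 ^ p) ^ 10 *
      Fintype.card (FixedVec p s d) ^ 3) = Z)
    (layers : List (TransformerLayer p s d)) {l : List (CRaspFormula σ)} {B D : ℕ}
    (hl : Admissible l B D (2 * p + 1)) {idx : FixedVec p s d → ℕ}
    {H : ∀ w : List σ, Fin (w.length + 1) → FixedVec p s d} (hc : Computes l idx H)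
    {z : FixedVec p s d} (hz : ∀ w, H w 0 = z) :
    ∃ l' idx', Admissible l' (B + layers.length * Z) (D + layers.length) (2 * p + 1) ∧
      Computes l' idx' fun w => layers.foldl (fun h Λ => Λ.apply h) (H w) := by
  induction layers generalizing l B D idx H z with
  | nil => exact ⟨l, idx, by simpa using hl, hc⟩
  | cons Λ layers ih =>
    obtain ⟨l₁, idx₁, h1, h2⟩ := exists_append_computes hl (Nat.le_succ D) (layerFormula Λ idx z)
      (Bounded.layerFormula hp hc.1 hl.depth_le) (size_layerFormula_le hp hd)
      (fun w => Λ.apply (H w)) fun w i v => sat_layerFormula hp hs hc w (hz w) i v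
    rw [hZ] at h1
    -- The new state of position `0` is that of a string of length one, hence again independent of
    -- `w`.
    obtain ⟨l', idx', h3, h4⟩ := ih h1 h2 (z := Λ.apply (fun _ : Fin 1 => z) 0) fun w => by
      rw [Λ.apply_zero, hz]
    refine ⟨l', idx', ?_, h4⟩
    convert h3 using 1
    · rw [List.length_cons]; ring
    · rw [List.length_cons]; omega

theorem exists_simulates [Fintype σ] [Nonempty σ] (hp : 1 ≤ p) (hs : s ≤ p) (hd : 1 ≤ d)
    (T : FixedTransformer (Option σ) p s d) :
    ∃ P : CRaspProgram σ, P.Simulates T ∧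
      P.size ≤ 20 * Fintype.card σ * 2 ^ (p * d)
        + T.depth * (1464 * d * 2 ^ (10 * p + 4 * (p * d))) + 8 * 2 ^ (p * d) ∧
      P.depth ≤ T.depth ∧ P.precision ≤ 2 * p + 1 ∧ P.girth ≤ 2 * p + 1 := by
  have hq : 1 ≤ 2 * p + 1 := by omega
  obtain ⟨l₀, idx₀, h1, h2⟩ := exists_append_computes (σ := σ)
    (Admissible.nil 0 0 (2 * p + 1)) le_rfl (fun v => symbolFormula fun a => T.embed a = v)
    (fun v => Bounded.symbolFormula hq _) (fun v => size_symbolFormula_le _)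
    (fun w i => T.embed (withBOS w i)) (fun w i v => sat_symbolFormula _ _ _ _)
  obtain ⟨l, idx, h3, h4⟩ := exists_computes_layers hp hs hd rfl T.layers h1 h2
    (z := T.embed none) fun w => rfl
  obtain ⟨P, h5, h6, h7, h8, h9⟩ := exists_of_admissible h3
    (φ := bigDisj fun v => guarded (0 < (T.unembed v).toReal) (ref (idx v)))
    (.bigDisj hq fun v => .guarded hq (.ref (h4.1 v) (h3.depth_le _)))
  refine ⟨P, fun w i => ?_, h6.trans ?_, h7.trans ?_, h8, h9⟩
  · rw [h5]
    simp only [sat_bigDisj, sat_guarded, sat_ref, h4.2]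
    constructor
    · rintro ⟨v, hv, rfl⟩; exact hv
    · intro hv; exact ⟨_, hv, rfl⟩
  · have h10 : (bigDisj fun v => guarded (0 < (T.unembed v).toReal)
        (ref (idx v) : CRaspFormula σ)).size ≤ Fintype.card (FixedVec p s d) * (2 + 4) + 2 :=
      size_bigDisj_le fun v => size_guarded_le le_rfl (by simp [CRaspFormula.size])
    rw [FixedVec.card_eq hp] at h10 ⊢
    have h11 : 2 ^ (p * d) * (1464 * d * (2 ^ p) ^ 10 * (2 ^ (p * d)) ^ 3)
        = 1464 * d * 2 ^ (10 * p + 4 * (p * d)) := by ring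
    rw [h11, FixedTransformer.depth]
    have h12 : 1 ≤ 2 ^ (p * d) := Nat.one_le_two_pow
    nlinarith
  · rw [zero_add]; rfl

/-- With one bit, the output depends only on the current symbol. -/
theorem exists_simulates_one_bit [Fintype σ] [Nonempty σ]
    (T : FixedTransformer (Option σ) 1 s d) :
    ∃ P : CRaspProgram σ, P.Simulates T ∧ P.size ≤ 20 * Fintype.card σ ∧
      P.depth ≤ 0 ∧ P.precision ≤ 1 ∧ P.girth ≤ 1 := by
  let G : FixedVec 1 s d → FixedVec 1 s d := fun v =>
    T.layers.foldl (fun v Λ => Λ.ff fun c => round 1 s ((round 1 s 0).toReal + (v c).toReal)) v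
  have hG : ∀ {n : ℕ} (layers : List (TransformerLayer 1 s d)) (h : Fin n → FixedVec 1 s d)
      (i : Fin n), layers.foldl (fun h Λ => Λ.apply h) h i = layers.foldl (fun v Λ => Λ.ff fun c =>
        round 1 s ((round 1 s 0).toReal + (v c).toReal)) (h i) := by
    intro n layers
    induction layers with
    | nil => intro h i; rfl
    | cons Λ layers ih =>
      intro h i
      rw [List.foldl_cons, List.foldl_cons, ih, Λ.apply_one_bit]
  obtain ⟨P, h5, h6, h7, h8, h9⟩ := exists_of_admissible (Admissible.nil (σ := σ) 0 0 1)
    (Bounded.symbolFormula le_rfl fun a => 0 < (T.unembed (G (T.embed a))).toReal)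
  refine ⟨P, fun w i => ?_, ?_, h7, h8, h9⟩
  · rw [h5, sat_symbolFormula, FixedTransformer.output, FixedTransformer.hidden, hG]
  · have := size_symbolFormula_le (σ := σ) fun a => 0 < (T.unembed (G (T.embed a))).toReal
    omega

end CRaspProgram

/-! ### The numerical estimate and the conclusion. -/

/-- Equality holds at `p = 2`, which is where `20` comes from. For `p = 1` the inequality fails for
large `d`, so that case needs a construction of its own. -/
theorem ten_mul_add_le_cube_mul_add {p d : ℕ} (hp : 2 ≤ p) (hd : 1 ≤ d) :
    10 * p + 4 * (p * d) ≤ 20 + p ^ 3 * d := by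
  rcases (show p = 2 ∨ p = 3 ∨ 4 ≤ p by omega) with rfl | rfl | h
  · omega
  · omega
  · obtain ⟨d, rfl⟩ := Nat.exists_eq_add_of_le' hd
    have h1 : 16 * p ≤ p ^ 3 := by
      rw [show p ^ 3 = p * p * p by ring]
      exact Nat.mul_le_mul_right p (Nat.mul_le_mul h h)
    nlinarith [Nat.mul_le_mul_right d h1]

theorem mainTheorem8 :
    ∃ C : ℕ, ∀ (σ : Type u) [Fintype σ] [Nonempty σ] (p s d L : ℕ),
      1 ≤ p → s ≤ p → 1 ≤ d → 1 ≤ L →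
      ∀ T : FixedTransformer (Option σ) p s d, T.depth = L →
        ∃ P : CRaspProgram σ, P.Simulates T ∧
          P.size ≤ C * (Fintype.card σ * L * p ^ 2 * d * 2 ^ (p ^ 3 * d)) ∧
          P.depth ≤ C * L ∧
          P.precision ≤ C * p ∧
          P.girth ≤ C * p := by
  -- `1492 = 20 + 1464 + 8` adds the costs of embedding, layers and output line; `2 ^ 20` is the
  -- excess of the exponent `10 * p + 4 * (p * d)` over `p ^ 3 * d`.
  refine ⟨1492 * 2 ^ 20, fun σ _ _ p s d L hp hs hd hL T hT => ?_⟩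
  have hσ := Fintype.card_pos (α := σ)
  rcases hp.eq_or_lt with rfl | hp2
  · obtain ⟨P, h1, h2, h3, h4, h5⟩ := CRaspProgram.exists_simulates_one_bit T
    refine ⟨P, h1, h2.trans ?_, h3.trans (Nat.zero_le _), h4.trans (by norm_num),
      h5.trans (by norm_num)⟩
    have : Fintype.card σ ≤ Fintype.card σ * (L * 1 ^ 2 * d * 2 ^ (1 ^ 3 * d)) :=
      Nat.le_mul_of_pos_right _ (by positivity)
    calc 20 * Fintype.card σ
        ≤ 1492 * 2 ^ 20 * (Fintype.card σ * (L * 1 ^ 2 * d * 2 ^ (1 ^ 3 * d))) :=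
          Nat.mul_le_mul (by norm_num) this
      _ = _ := by ring
  · obtain ⟨P, h1, h2, h3, h4, h5⟩ := CRaspProgram.exists_simulates hp hs hd T
    rw [hT] at h2 h3
    refine ⟨P, h1, h2.trans ?_, h3.trans (Nat.le_mul_of_pos_left _ (by norm_num)),
      h4.trans (by omega), h5.trans (by omega)⟩
    have hE : 2 ^ (10 * p + 4 * (p * d)) ≤ 2 ^ 20 * 2 ^ (p ^ 3 * d) := by
      rw [← pow_add]
      exact Nat.pow_le_pow_right (by norm_num) (ten_mul_add_le_cube_mul_add hp2 hd)
    have hQ : 2 ^ (p * d) ≤ 2 ^ (10 * p + 4 * (p * d)) :=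
      Nat.pow_le_pow_right (by norm_num) (by omega)
    have hA : 1 ≤ L * p ^ 2 * d := Nat.mul_pos (Nat.mul_pos hL (by positivity)) hd
    generalize 2 ^ (10 * p + 4 * (p * d)) = E at *
    generalize 2 ^ (p ^ 3 * d) = F at *
    generalize 2 ^ (p * d) = Q at *
    generalize Fintype.card σ = c at *
    have e1 : c * Q ≤ c * L * p ^ 2 * d * E := by
      calc c * Q ≤ c * E := Nat.mul_le_mul_left c hQ
        _ ≤ c * E * (L * p ^ 2 * d) := Nat.le_mul_of_pos_right _ hA
        _ = _ := by ring
    have e2 : Q ≤ c * Q := Nat.le_mul_of_pos_left _ hσ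
    have e3 : L * (d * E) ≤ c * L * p ^ 2 * d * E := by
      calc L * (d * E) ≤ L * (d * E) * (c * p ^ 2) :=
            Nat.le_mul_of_pos_right _ (Nat.mul_pos hσ (by positivity))
        _ = _ := by ring
    calc 20 * c * Q + L * (1464 * d * E) + 8 * Q
        = 20 * (c * Q) + 1464 * (L * (d * E)) + 8 * Q := by ring
      _ ≤ 1492 * (c * L * p ^ 2 * d * E) := by omega
      _ ≤ 1492 * (c * L * p ^ 2 * d * (2 ^ 20 * F)) :=
          Nat.mul_le_mul_left _ (Nat.mul_le_mul_left _ hE)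
      _ = 1492 * 2 ^ 20 * (c * L * p ^ 2 * d * F) := by ring
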